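/- An integral domain $\mathcal{O}$ with field of fractions $K$ is called a Krull ring if there is a family $(v_i)_{i\in I}$ of discrete valuations of $K$ (with value group $\mathbb{Z}$) such that $\mathcal{O}=\bigcap_{i}\{x\in K : v_i(x)\ge 0\}$ and such that for every $x\in K^\times$ one has $v_i(x)\ne 0$ for only finitely many $i$. An algebra $B$ over a field $k$ is called split semisimple if it is semisimple and $\mathrm{End}_B(V)\simeq k$ for every simple $B$-module $V$. Let $\mathcal{O}$ be a Krull ring with field of fractions $K$, and let $A$ be an $\mathcal{O}$-algebra which is free and finitely generated as an $\mathcal{O}$-module. Let $t:A\to\mathcal{O}$ be a symmetrizing form, i.e. an $\mathcal{O}$-linear map with $t(ab)=t(ba)$ for all $a,b\in A$ such that $a\mapsto(x\mapsto t(ax))$ is an isomorphism $A\to\mathrm{Hom}_{\mathcal{O}}(A,\mathcal{O})$, and let $t^K$ be its $K$-linear extension to $KA:=K\otimes_{\mathcal{O}}A$. Assume that $KA$ is split semisimple. For a simple $KA$-module $V$ with character $\chi_V:KA\to K$, let $\chi_V^\vee$ be the (central) element of $KA$ with $t^K(\chi_V^\vee a)=\chi_V(a)$ for all $a\in KA$,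 and let the Schur element $s_V\in K$ be the scalar by which $\chi_V^\vee$ acts on $V$. Let $\theta:\mathcal{O}\to L$ be a ring homomorphism into a field $L$ such that $L$ is the field of fractions of $\theta(\mathcal{O})$, and suppose that $\mathrm{Ker}\,\theta$ is a prime ideal of $\mathcal{O}$ of height $1$. Then every Schur element $s_V$ is well defined and lies in $\mathcal{O}$, and $LA:=L\otimes_{\mathcal{O}}A$ (formed via $\theta$) is split semisimple if and only if $\theta(s_V)\neq 0$ for every simple $KA$-module $V$. -/

import Mathlib

open scoped TensorProduct

universe u v w x

/-- An integral domain `R` with field of fractions `F` is a Krull ring if there is a family of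
discrete valuations of `F` (value group `ℤ`, written multiplicatively with a zero adjoined) such
that `R` is the intersection of their valuation rings, and such that every nonzero element of `F`
is a unit for all but finitely many of them. -/
def IsKrullRing (R : Type u) (F : Type v) [CommRing R] [IsDomain R] [Field F] [Algebra R F]
    [IsFractionRing R F] : Prop :=
  ∃ S : Set (Valuation F (WithZero (Multiplicative ℤ))),
    (∀ ν ∈ S, Function.Surjective ν) ∧
    (∀ x : F, (∀ ν ∈ S, ν x ≤ 1) ↔ x ∈ Set.range (algebraMap R F)) ∧
    (∀ x : F, x ≠ 0 → {ν ∈ S | ν x ≠ 1}.Finite)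

/-- A `K`-algebra `B` is split if `End_B(V) ≃ K` for every simple `B`-module `V`. (Every simple
`B`-module is isomorphic to a quotient of `B`, so the universe of `B` suffices.) -/
def IsSplitAlgebra (K : Type u) (B : Type v) [Field K] [Ring B] [Algebra K B] : Prop :=
  ∀ (V : Type v) [AddCommGroup V] [Module B V] [Module K V] [IsScalarTower K B V],
    IsSimpleModule B V → Nonempty (Module.End B V ≃ₐ[K] K)

/-- A `K`-algebra is split semisimple if it is semisimple and split. -/
def IsSplitSemisimple (K : Type u) (B : Type v) [Field K] [Ring B] [Algebra K B] : Prop :=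
  IsSemisimpleRing B ∧ IsSplitAlgebra K B

/-- `t` is a symmetrizing form on the `R`-algebra `A`: a trace function such that
`a ↦ (x ↦ t (a * x))` is an isomorphism from `A` onto its `R`-dual. -/
structure IsSymmetrizingForm {R : Type u} {A : Type v} [CommRing R] [Ring A] [Algebra R A]
    (t : A →ₗ[R] R) : Prop where
  trace_comm : ∀ a b : A, t (a * b) = t (b * a)
  bijective : Function.Bijective (fun a : A => t ∘ₗ LinearMap.mulLeft R a)

/-- The extension of scalars `t^K : K ⊗ A → K` of a linear form `t : A → R`, with
`t^K (c ⊗ a) = c * t a`. -/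
noncomputable def extendForm {R : Type u} (K : Type v) {A : Type w} [CommRing R] [Field K]
    [Algebra R K] [Ring A] [Algebra R A] (t : A →ₗ[R] R) : (K ⊗[R] A) →ₗ[K] K :=
  (TensorProduct.AlgebraTensorModule.rid R K K).toLinearMap ∘ₗ t.baseChange K

/-- The character of a `B`-module `V`: `b` is sent to the trace of its action on the `K`-vector
space `V`. -/
noncomputable def moduleCharacter (K : Type u) (B : Type v) (V : Type w) [Field K] [Ring B]
    [Algebra K B] [AddCommGroup V] [Module B V] [Module K V] [IsScalarTower K B V] : B →ₗ[K] K :=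
  LinearMap.trace K V ∘ₗ (Algebra.lsmul K K V : B →ₐ[K] Module.End K V).toLinearMap

/-- `s` is the Schur element of the simple `B`-module `V` with respect to the symmetrizing form
`τ` on `B`: if `z` is the element of `B` with `τ (z * b) = χ_V b` for all `b`, then `s` is the
scalar by which `z` acts on `V`. -/
def IsSchurElement {K : Type u} {B : Type v} [Field K] [Ring B] [Algebra K B] (τ : B →ₗ[K] K)
    (V : Type w) [AddCommGroup V] [Module B V] [Module K V] [IsScalarTower K B V] (s : K) : Prop :=
  ∃ z : B, (∀ b : B, τ (z * b) = moduleCharacter K B V b) ∧ ∀ x : V, z • x = s • x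

/-- A ring homomorphism `θ : R → L` into a field is a specialization of `R` if `L` is the field
of fractions of `θ(R)`. -/
def IsSpecialization {R : Type u} {L : Type v} [CommRing R] [Field L] (θ : R →+* L) : Prop :=
  IsFractionRing θ.range L

/-!
On each matrix factor of the split semisimple algebra `KA` the symmetrizing form is a multiple of
the matrix trace, and the Schur element `s i` of the corresponding simple module is the inverse of
this multiple. If `β` and `β'` are dual for the form, Schur's relations say that the matrix
coefficients of the irreducible representations satisfy `∑ j, ρ i (β' j) p q * ρ l (β j) a b = s i`
when `l = i`, `a = q`, `b = p`, while all other such sums vanish.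

It follows that `s i` is the scalar by which `∑ j, χ i (β' j) • β j` acts on the `i`-th simple
module. Over an integrally closed `O`, characters take values in `O` on `A`, so this is the action
of an element of `A`; hence `s i` is integral over `O` and lies in `O`.

The localization of a Krull ring at a prime of height one is a valuation ring, over which the
irreducible representations of `KA` can be realized by means of lattices. Schur's relations then
hold over this ring and reduce to `L`. If no `s i` vanishes in `L`, they show that the reduced
representations map `LA` onto the product of the matrix algebras, bijectively because the dimensions
agree. If `s i` vanishes in `L`, then the element `w` of `LA` dual to a diagonal matrix coefficient
of the `i`-th reduced representation is killed by that representation. In a semisimple algebra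
`w = w * c * w` for some `c`, so the coefficient takes the same value at `1` and at `w * c`; but
these values are `1` and `0`.
-/
section DualSystems

variable {R : Type u} {A : Type v} [CommRing R] [Ring A] [Algebra R A] {t : A →ₗ[R] R}
  {κ : Type*} [Fintype κ] {β β' : κ → A}

/-- The families `β` and `β'` are dual for the form `t`. They are dual bases when `A` is free and
the families are bases; allowing arbitrary families covers every finite projective `A`. -/
def IsDualSystem (t : A →ₗ[R] R) (β β' : κ → A) : Prop :=
  ∀ a, ∑ j, t (β' j * a) • β j = a

theorem IsSymmetrizingForm.exists_isDualSystem [Module.Finite R A] [Module.Projective R A]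
    (ht : IsSymmetrizingForm t) : ∃ (n : ℕ) (β β' : Fin n → A), IsDualSystem t β β' := by
  obtain ⟨n, f, g, -, -, hfg⟩ := Module.Finite.exists_comp_eq_id_of_projective R A
  choose β' hβ' using fun j => ht.bijective.2 (LinearMap.proj j ∘ₗ g)
  refine ⟨n, fun j => f (Pi.single j 1), β', fun a => ?_⟩
  have coord (j : Fin n) : t (β' j * a) = g a j := LinearMap.congr_fun (hβ' j) a
  calc ∑ j, t (β' j * a) • f (Pi.single j 1) = f (∑ j, Pi.single j (g a j)) := by
        simp [coord, ← map_smul, ← Pi.single_smul]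
    _ = f (g a) := by rw [Finset.univ_sum_single]
    _ = a := LinearMap.congr_fun hfg a

theorem IsDualSystem.eq_of_forall_mul (h : IsDualSystem t β β') {x y : A}
    (hxy : ∀ b, t (b * x) = t (b * y)) : x = y := by
  rw [← h x, ← h y]
  simp only [hxy]

theorem IsDualSystem.symm (h : IsDualSystem t β β') (ht : ∀ a b, t (a * b) = t (b * a)) :
    IsDualSystem t β' β := by
  refine fun b => h.eq_of_forall_mul fun c => ?_
  calc t (c * ∑ j, t (β j * b) • β' j) = t (b * ∑ j, t (β' j * c) • β j) := by
        simp only [Finset.mul_sum, mul_smul_comm, map_sum, map_smul, smul_eq_mul]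
        exact Finset.sum_congr rfl fun j _ => by rw [ht (β j), ht c, mul_comm]
    _ = t (c * b) := by rw [h c, ht]

theorem IsDualSystem.form_mul_sum (h : IsDualSystem t β β') (ht : ∀ a b, t (a * b) = t (b * a))
    (f : A →ₗ[R] R) (b : A) : t (b * ∑ j, f (β' j) • β j) = f b := by
  conv_rhs => rw [← h.symm ht b]
  simp only [Finset.mul_sum, mul_smul_comm, map_sum, map_smul, smul_eq_mul]
  exact Finset.sum_congr rfl fun j _ => by rw [ht b, mul_comm]

end DualSystems

section ExtendForm

variable {R : Type u} {A : Type w} [CommRing R] [Ring A] [Algebra R A] {t : A →ₗ[R] R}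
  (F : Type v) [Field F] [Algebra R F]

theorem extendForm_tmul (t : A →ₗ[R] R) (c : F) (a : A) :
    extendForm F t (c ⊗ₜ[R] a) = t a • c := by
  simp [extendForm]

theorem extendForm_trace_comm (ht : ∀ a b, t (a * b) = t (b * a)) (a b : F ⊗[R] A) :
    extendForm F t (a * b) = extendForm F t (b * a) := by
  induction a with
  | zero => simp
  | add a₁ a₂ h₁ h₂ => simp only [add_mul, mul_add, map_add, h₁, h₂]
  | tmul c a =>
    induction b with
    | zero => simp
    | add b₁ b₂ h₁ h₂ => simp only [add_mul, mul_add, map_add, h₁, h₂]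
    | tmul d b =>
      simp only [Algebra.TensorProduct.tmul_mul_tmul, extendForm_tmul, ht a b, mul_comm c d]

theorem IsDualSystem.baseChange {κ : Type*} [Fintype κ] {β β' : κ → A}
    (h : IsDualSystem t β β') :
    IsDualSystem (extendForm F t) (fun j => 1 ⊗ₜ β j) (fun j => 1 ⊗ₜ β' j) := by
  intro x
  induction x with
  | zero => simp
  | add x y hx hy =>
    simp only [mul_add, map_add, add_smul, Finset.sum_add_distrib, hx, hy]
  | tmul c a =>
    calc ∑ j, extendForm F t ((1 ⊗ₜ β' j) * (c ⊗ₜ[R] a)) • ((1 : F) ⊗ₜ[R] β j)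
        = ∑ j, c ⊗ₜ[R] (t (β' j * a) • β j) := by
          simp [extendForm_tmul, TensorProduct.smul_tmul', TensorProduct.tmul_smul]
      _ = c ⊗ₜ a := by rw [← TensorProduct.tmul_sum, h a]

end ExtendForm

section MatrixRepresentations

open scoped Matrix

variable {k : Type u} {B : Type v} [Field k] [Ring B] [Algebra k B]
  {n : Type*} [Fintype n] [DecidableEq n] {ρ : B →ₐ[k] Matrix n n k}
  {V : Type w} [AddCommGroup V] [Module k V] [Module B V]

/-- The `B`-module `V` affords the matrix representation `ρ`: in suitable `k`-linear coordinates
on `V`, the action of `b` is multiplication by the matrix `ρ b`. -/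
def Affords (ρ : B →ₐ[k] Matrix n n k) (V : Type w) [AddCommGroup V] [Module k V]
    [Module B V] : Prop :=
  ∃ e : (n → k) ≃ₗ[k] V, ∀ b x, e (ρ b *ᵥ x) = b • e x

theorem Affords.nonempty [Nontrivial V] (h : Affords ρ V) : Nonempty n := by
  obtain ⟨e, -⟩ := h
  have : Nontrivial (n → k) := e.toEquiv.nontrivial
  by_contra! hn
  exact not_subsingleton (n → k) inferInstance

theorem Affords.isSimpleModule [Nonempty n] (h : Affords ρ V) (hρ : Function.Surjective ρ) :
    IsSimpleModule B V := by
  obtain ⟨e, he⟩ := h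
  have : Nontrivial V := e.symm.toEquiv.nontrivial
  refine isSimpleModule_iff_toSpanSingleton_surjective.2 ⟨inferInstance, fun v hv w => ?_⟩
  obtain ⟨p, hp⟩ : ∃ p, e.symm v p ≠ 0 := by
    by_contra! hzero
    exact hv (e.symm.map_eq_zero_iff.1 (funext hzero))
  obtain ⟨b, hb⟩ := hρ (Matrix.vecMulVec (e.symm w) (Pi.single p (e.symm v p)⁻¹))
  refine ⟨b, ?_⟩
  have := he b (e.symm v)
  rw [e.apply_symm_apply] at this
  simp [← this, hb, Matrix.vecMulVec_mulVec, hp]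

theorem Affords.forall_smul_eq_iff (h : Affords ρ V) {b : B} {c : k} :
    (∀ v : V, b • v = c • v) ↔ ρ b = algebraMap k _ c := by
  obtain ⟨e, he⟩ := h
  rw [e.surjective.forall, ← Matrix.mulVec_injective.eq_iff,
    funext_iff]
  refine forall_congr' fun x => ?_
  rw [← he, ← map_smul, e.injective.eq_iff, Algebra.algebraMap_eq_smul_one, Matrix.smul_mulVec,
    Matrix.one_mulVec]

variable [IsScalarTower k B V]

theorem Affords.congr {V' : Type*} [AddCommGroup V'] [Module k V'] [Module B V']
    [IsScalarTower k B V'] (h : Affords ρ V) (f : V ≃ₗ[B] V') : Affords ρ V' := by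
  obtain ⟨e, he⟩ := h
  exact ⟨e.trans (f.restrictScalars k), fun b x => by simp [he]⟩

theorem Affords.moduleCharacter_eq (h : Affords ρ V) (b : B) :
    moduleCharacter k B V b = (ρ b).trace := by
  obtain ⟨e, he⟩ := h
  have conj : Algebra.lsmul k k V b = e.conj (Matrix.toLin' (ρ b)) := by
    ext x
    simp [LinearEquiv.conj_apply, he]
  calc moduleCharacter k B V b = LinearMap.trace k V (Algebra.lsmul k k V b) := rfl
    _ = (ρ b).trace := by rw [conj, LinearMap.trace_conj', Matrix.trace_toLin'_eq]

theorem Affords.nonempty_end_algEquiv [Nonempty n] (h : Affords ρ V) (hρ : Function.Surjective ρ) :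
    Nonempty (Module.End B V ≃ₐ[k] k) := by
  have := h.isSimpleModule hρ
  have := IsSimpleModule.nontrivial B V
  obtain ⟨e, he⟩ := h
  refine ⟨(AlgEquiv.ofBijective (Algebra.ofId k (Module.End B V))
    ⟨(algebraMap k (Module.End B V)).injective, fun g => ?_⟩).symm⟩
  set M : Matrix n n k := LinearMap.toMatrix' (e.symm.conj (g.restrictScalars k)) with hM
  have e_mulVec (x : n → k) : e (M *ᵥ x) = g (e x) := by
    simp [hM, LinearEquiv.conj_apply]
  obtain ⟨c, hc⟩ : M ∈ Set.range (Matrix.scalar n) := by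
    refine Matrix.mem_range_scalar_of_commute_single fun i j _ => ?_
    obtain ⟨b, hb⟩ := hρ (Matrix.single i j 1)
    refine Matrix.mulVec_injective (funext fun x => e.injective ?_)
    rw [← hb, ← Matrix.mulVec_mulVec, ← Matrix.mulVec_mulVec, he, e_mulVec, e_mulVec, he, map_smul]
  refine ⟨c, LinearMap.ext (e.surjective.forall.2 fun x => ?_)⟩
  simp [← e_mulVec, ← hc, Algebra.ofId_apply, Matrix.scalar_apply]

end MatrixRepresentations

section MatrixFactors

open scoped Matrix

variable {k : Type u} {B : Type v} [Field k] [Ring B] [Algebra k B] {ι : Type*}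
  {n : ι → Type*} [∀ i, Fintype (n i)] [∀ i, DecidableEq (n i)]
  (φ : B ≃ₐ[k] Π i, Matrix (n i) (n i) k)

/-- The matrix representation of `B` on the `i`-th factor of a decomposition of `B` into matrix
algebras. -/
def factorRep (i : ι) : B →ₐ[k] Matrix (n i) (n i) k :=
  (Pi.evalAlgHom k _ i).comp φ.toAlgHom

@[simp]
theorem factorRep_apply (i : ι) (b : B) : factorRep φ i b = φ b i := rfl

theorem factorRep_surjective (i : ι) : Function.Surjective (factorRep φ i) := by
  classical
  exact fun X => ⟨φ.symm (Pi.single i X), by simp⟩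

section

variable [DecidableEq ι]

/-- The embedding of the `i`-th matrix factor into `B`. It is not unital when there are several
factors. -/
def factorEmb (i : ι) : Matrix (n i) (n i) k →ₗ[k] B :=
  φ.symm.toLinearMap ∘ₗ LinearMap.single k (fun i => Matrix (n i) (n i) k) i

@[simp]
theorem apply_factorEmb (i : ι) (X : Matrix (n i) (n i) k) :
    φ (factorEmb φ i X) = Pi.single i X := by
  simp [factorEmb]

theorem mul_factorEmb (i : ι) (b : B) (X : Matrix (n i) (n i) k) :
    b * factorEmb φ i X = factorEmb φ i (φ b i * X) := by
  apply φ.injective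
  ext j : 1
  rcases eq_or_ne j i with rfl | hj
  · simp
  · simp [Pi.single_eq_of_ne hj]

/-- The left ideal of `B` generated by a diagonal matrix unit of the `i`-th factor. It is the
space of matrices concentrated in the `r`-th column of that factor. -/
def columnIdeal (i : ι) (r : n i) : Submodule B B :=
  Submodule.span B {factorEmb φ i (Matrix.single r r 1)}

theorem affords_columnIdeal (i : ι) (r : n i) : Affords (factorRep φ i) (columnIdeal φ i r) := by
  let column : (n i → k) →ₗ[k] B :=
    factorEmb φ i ∘ₗ (vecMulVecBilin k k).flip (Pi.single r 1)
  have column_apply (x : n i → k) :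
      column x = factorEmb φ i (Matrix.vecMulVec x (Pi.single r 1)) := rfl
  have column_mulVec (b : B) (x : n i → k) : column (φ b i *ᵥ x) = b * column x := by
    simp only [column_apply, mul_factorEmb, Matrix.mul_vecMulVec]
  have mul_generator (b : B) :
      b * factorEmb φ i (Matrix.single r r 1) = column (φ b i *ᵥ Pi.single r 1) := by
    rw [column_mulVec, column_apply, Matrix.single_eq_single_vecMulVec_single]
  have recover (x : n i → k) : φ (column x) i *ᵥ Pi.single r 1 = x := by
    rw [column_apply, apply_factorEmb, Pi.single_eq_same, Matrix.vecMulVec_mulVec]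
    simp
  have mem (x : n i → k) : column x ∈ columnIdeal φ i r :=
    Submodule.mem_span_singleton.2 ⟨column x, by rw [smul_eq_mul, mul_generator, recover]⟩
  have injective : Function.Injective column :=
    Function.LeftInverse.injective (g := fun b => φ b i *ᵥ Pi.single r 1) recover
  refine ⟨LinearEquiv.ofBijective
    (column.codRestrict ((columnIdeal φ i r).restrictScalars k) mem) ⟨?_, ?_⟩, ?_⟩
  · exact fun x y hxy => injective (congr_arg Subtype.val hxy)
  · rintro ⟨y, hy⟩
    obtain ⟨b, rfl⟩ := Submodule.mem_span_singleton.1 hy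
    exact ⟨_, Subtype.ext (mul_generator b).symm⟩
  · exact fun b x => Subtype.ext (column_mulVec b x)

theorem isSimpleModule_columnIdeal (i : ι) (r : n i) : IsSimpleModule B (columnIdeal φ i r) :=
  have : Nonempty (n i) := ⟨r⟩
  (affords_columnIdeal φ i r).isSimpleModule (factorRep_surjective φ i)

end

theorem exists_affords_of_isSimpleModule [Finite ι] {V : Type w} [AddCommGroup V] [Module k V]
    [Module B V] [IsScalarTower k B V] (hV : IsSimpleModule B V) :
    ∃ i, Affords (factorRep φ i) V := by
  classical
  have := Fintype.ofFinite ι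
  have := IsSimpleModule.nontrivial B V
  obtain ⟨v, hv⟩ := exists_ne (0 : V)
  have one_eq : ∑ i, ∑ r, factorEmb φ i (Matrix.single r r 1) = 1 := by
    apply φ.injective
    simp only [← map_sum, Matrix.sum_single_one]
    simpa using Finset.univ_sum_single (1 : Π i, Matrix (n i) (n i) k)
  obtain ⟨i, r, hir⟩ : ∃ i r, factorEmb φ i (Matrix.single r r 1) • v ≠ 0 := by
    by_contra! hzero
    apply hv
    rw [← one_smul B v, ← one_eq]
    simp [Finset.sum_smul, hzero]
  have := isSimpleModule_columnIdeal φ i r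
  let f : columnIdeal φ i r →ₗ[B] V := LinearMap.toSpanSingleton B V v ∘ₗ Submodule.subtype _
  have hf : f ≠ 0 := fun h =>
    hir (LinearMap.congr_fun h ⟨_, Submodule.mem_span_singleton_self _⟩)
  exact ⟨i, (affords_columnIdeal φ i r).congr
    (LinearEquiv.ofBijective f (LinearMap.bijective_of_ne_zero hf))⟩

end MatrixFactors

theorem isSplitSemisimple_of_algEquiv {k : Type u} {B : Type v} [Field k] [Ring B] [Algebra k B]
    {ι : Type*} [Finite ι] {n : ι → Type*} [∀ i, Fintype (n i)] [∀ i, DecidableEq (n i)]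
    (φ : B ≃ₐ[k] Π i, Matrix (n i) (n i) k) : IsSplitSemisimple k B := by
  refine ⟨φ.symm.toRingEquiv.isSemisimpleRing, fun V _ _ _ _ hV => ?_⟩
  classical
  obtain ⟨i, hi⟩ := exists_affords_of_isSimpleModule φ hV
  have := IsSimpleModule.nontrivial B V
  have := hi.nonempty
  exact hi.nonempty_end_algEquiv (factorRep_surjective φ i)

theorem IsSplitSemisimple.exists_algEquiv {k : Type u} {B : Type v} [Field k] [Ring B]
    [Algebra k B] (h : IsSplitSemisimple k B) :
    ∃ (m : ℕ) (d : Fin m → ℕ), (∀ i, NeZero (d i)) ∧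
      Nonempty (B ≃ₐ[k] Π i, Matrix (Fin (d i)) (Fin (d i)) k) := by
  obtain ⟨_, hsplit⟩ := h
  obtain ⟨m, S, d, hS, hd, ⟨e⟩⟩ :=
    IsSemisimpleRing.exists_algEquiv_pi_matrix_end_mulOpposite k B
  refine ⟨m, d, hd, ⟨e.trans (AlgEquiv.piCongrRight fun i => ?_)⟩⟩
  exact ((hsplit (S i) (hS i)).some.op.trans (AlgEquiv.toOpposite k k).symm).mapMatrix

theorem exists_eq_mul_trace {R n : Type*} [CommSemiring R] [Fintype n]
    (f : Matrix n n R →ₗ[R] R) (hf : ∀ X Y, f (X * Y) = f (Y * X)) :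
    ∃ c, ∀ X, f X = c * X.trace := by
  classical
  cases isEmpty_or_nonempty n with
  | inl _ => exact ⟨0, fun X => by simp [Subsingleton.elim X 0]⟩
  | inr h =>
    obtain ⟨r⟩ := h
    have apply_single (p q : n) :
        f (Matrix.single p q 1) = f (Matrix.single r r 1) * (Matrix.single p q (1 : R)).trace := by
      have factor : Matrix.single p q (1 : R) = Matrix.single p r 1 * Matrix.single r q 1 := by simp
      rcases eq_or_ne p q with rfl | hpq
      · rw [factor, hf]
        simp
      · rw [factor, hf, Matrix.single_mul_single_of_ne _ _ _ _ hpq.symm]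
        simp [hpq]
    refine ⟨f (Matrix.single r r 1), fun X => ?_⟩
    refine LinearMap.congr_fun (f := f)
      (g := LinearMap.mulLeft R (f (Matrix.single r r 1)) ∘ₗ Matrix.traceLinearMap n R R) ?_ X
    refine Matrix.ext_linearMap R fun p q => LinearMap.ext_ring ?_
    simpa using apply_single p q

section SchurElements

variable {k : Type u} {B : Type v} [Field k] [Ring B] [Algebra k B] {ι : Type*} [DecidableEq ι]
  {n : ι → Type*} [∀ i, Fintype (n i)] [∀ i, DecidableEq (n i)]
  {φ : B ≃ₐ[k] Π i, Matrix (n i) (n i) k} {τ : B →ₗ[k] k} {s : ι → k}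
  {κ : Type*} [Fintype κ] {β β' : κ → B}

/-- On the `i`-th matrix factor the form `τ` is `(s i)⁻¹` times the matrix trace. The `s i` are the
Schur elements of the simple modules; this is their definition in terms of the matrix factors. -/
def IsSchurFamily (φ : B ≃ₐ[k] Π i, Matrix (n i) (n i) k) (τ : B →ₗ[k] k) (s : ι → k) : Prop :=
  ∀ i X, s i * τ (factorEmb φ i X) = X.trace

theorem IsDualSystem.exists_isSchurFamily (hβ : IsDualSystem τ β β')
    (hτ : ∀ a b, τ (a * b) = τ (b * a)) (φ : B ≃ₐ[k] Π i, Matrix (n i) (n i) k) :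
    ∃ s, IsSchurFamily φ τ s := by
  suffices ∀ i, ∃ c, ∀ X, c * τ (factorEmb φ i X) = X.trace by choose s hs using this; exact ⟨s, hs⟩
  intro i
  have factorEmb_mul (X Y : Matrix (n i) (n i) k) :
      factorEmb φ i (X * Y) = factorEmb φ i X * factorEmb φ i Y := by simp [mul_factorEmb]
  obtain ⟨c, hc⟩ := exists_eq_mul_trace (τ ∘ₗ factorEmb φ i) fun X Y => by
    simp only [LinearMap.comp_apply, factorEmb_mul, hτ]
  simp only [LinearMap.comp_apply] at hc
  rcases eq_or_ne c 0 with rfl | hc0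
  · refine ⟨0, fun X => ?_⟩
    have hX : factorEmb φ i X = 0 := hβ.eq_of_forall_mul fun b => by simp [mul_factorEmb, hc]
    have : X = 0 := by simpa [hX, eq_comm] using congr_fun (apply_factorEmb φ i X) i
    simp [this]
  · exact ⟨c⁻¹, fun X => by rw [hc, inv_mul_cancel_left₀ hc0]⟩

/-- The Schur relations between the matrix coefficients of the representations `σ i`: those of
different representations are orthogonal, and those of `σ i` are dual up to the factor `s i`. -/
def SchurRelations {O R A : Type*} [CommRing O] [CommRing R] [Algebra O R] [Ring A] [Algebra O A]
    (σ : Π i, A →ₐ[O] Matrix (n i) (n i) R) (β β' : κ → A) (s : ι → R) : Prop :=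
  ∀ i p q l a b, ∑ j, σ i (β' j) p q * σ l (β j) a b =
    s i * (Pi.single i (Matrix.single q p 1) : Π i, Matrix (n i) (n i) R) l a b

theorem SchurRelations.sum_smul {O R A : Type*} [CommRing O] [CommRing R] [Algebra O R] [Ring A]
    [Algebra O A] {σ : Π i, A →ₐ[O] Matrix (n i) (n i) R} {β β' : κ → A} {s : ι → R}
    (h : SchurRelations σ β β' s) (i : ι) (p q : n i) (l : ι) :
    ∑ j, σ i (β' j) p q • σ l (β j) =
      s i • (Pi.single i (Matrix.single q p 1) : Π i, Matrix (n i) (n i) R) l := by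
  ext a b
  simpa [Matrix.sum_apply] using h i p q l a b

theorem SchurRelations.sum_trace_smul {O R A : Type*} [CommRing O] [CommRing R] [Algebra O R]
    [Ring A] [Algebra O A] {σ : Π i, A →ₐ[O] Matrix (n i) (n i) R} {β β' : κ → A} {s : ι → R}
    (h : SchurRelations σ β β' s) (i : ι) :
    ∑ j, (σ i (β' j)).trace • σ i (β j) = s i • 1 := by
  calc ∑ j, (σ i (β' j)).trace • σ i (β j) = ∑ p, ∑ j, σ i (β' j) p p • σ i (β j) := by
        rw [Finset.sum_comm]
        simp only [Matrix.trace, Matrix.diag_apply, Finset.sum_smul]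
    _ = s i • 1 := by
        simp only [h.sum_smul, Pi.single_eq_same, ← Finset.smul_sum, Matrix.sum_single_one]

theorem IsSchurFamily.form_mul (hs : IsSchurFamily φ τ s) (i : ι) (b : B)
    (X : Matrix (n i) (n i) k) : τ (b * s i • factorEmb φ i X) = (φ b i * X).trace := by
  rw [mul_smul_comm, map_smul, smul_eq_mul, mul_factorEmb, hs]

theorem IsSchurFamily.schurRelations (hs : IsSchurFamily φ τ s) (hβ : IsDualSystem τ β β')
    (hτ : ∀ a b, τ (a * b) = τ (b * a)) : SchurRelations (factorRep φ) β β' s := by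
  intro i p q l a b
  let coeff : B →ₗ[k] k := Matrix.entryLinearMap k k p q ∘ₗ (factorRep φ i).toLinearMap
  have coeff_dual : ∑ j, coeff (β' j) • β j = s i • factorEmb φ i (Matrix.single q p 1) := by
    refine hβ.eq_of_forall_mul fun b => ?_
    rw [hβ.form_mul_sum hτ, hs.form_mul, Matrix.trace_mul_single]
    simp [coeff]
  simpa [coeff, Matrix.sum_apply] using congr_arg (fun y => φ y l a b) coeff_dual

theorem IsSchurFamily.isSchurElement_iff (hs : IsSchurFamily φ τ s) (hβ : IsDualSystem τ β β')
    (hτ : ∀ a b, τ (a * b) = τ (b * a)) {V : Type w} [AddCommGroup V] [Module k V] [Module B V]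
    [IsScalarTower k B V] [Nontrivial V] {i : ι} (hV : Affords (factorRep φ i) V) {c : k} :
    IsSchurElement τ V c ↔ c = s i := by
  have := hV.nonempty
  have character_dual (b : B) : τ (s i • factorEmb φ i 1 * b) = moduleCharacter k B V b := by
    rw [hτ, hs.form_mul, mul_one, hV.moduleCharacter_eq, factorRep_apply]
  have acts (c : k) : (∀ x : V, (s i • factorEmb φ i 1) • x = c • x) ↔ c = s i := by
    rw [hV.forall_smul_eq_iff, eq_comm, Algebra.algebraMap_eq_smul_one]
    simp [smul_left_inj]
  constructor
  · rintro ⟨z, hz, hzV⟩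
    have : z = s i • factorEmb φ i 1 := hβ.eq_of_forall_mul fun b => by
      rw [hτ, hz, hτ b, character_dual]
    exact (acts c).1 (this ▸ hzV)
  · exact fun hc => ⟨_, character_dual, (acts c).2 hc⟩

theorem IsSchurFamily.isSchurElement_columnIdeal (hs : IsSchurFamily φ τ s)
    (hβ : IsDualSystem τ β β') (hτ : ∀ a b, τ (a * b) = τ (b * a)) (i : ι) (r : n i) :
    IsSchurElement τ (columnIdeal φ i r) (s i) :=
  have := isSimpleModule_columnIdeal φ i r
  have := IsSimpleModule.nontrivial B (columnIdeal φ i r)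
  (hs.isSchurElement_iff hβ hτ (affords_columnIdeal φ i r)).2 rfl

theorem IsSchurFamily.exists_forall_isSchurElement_iff [Finite ι] (hs : IsSchurFamily φ τ s)
    (hβ : IsDualSystem τ β β') (hτ : ∀ a b, τ (a * b) = τ (b * a)) {V : Type w} [AddCommGroup V]
    [Module k V] [Module B V] [IsScalarTower k B V] (hV : IsSimpleModule B V) :
    ∃ i, ∀ c, IsSchurElement τ V c ↔ c = s i :=
  have := IsSimpleModule.nontrivial B V
  let ⟨i, hi⟩ := exists_affords_of_isSimpleModule φ hV
  ⟨i, fun _ => hs.isSchurElement_iff hβ hτ hi⟩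

end SchurElements

section Integrality

variable {O K : Type*} [CommRing O] [Field K] [Algebra O K]

theorem isIntegral_of_mem_spectrum {B : Type*} [Ring B] [Algebra K B] [Algebra O B]
    [IsScalarTower O K B] {b : B} (hb : IsIntegral O b) {c : K} (hc : c ∈ spectrum K b) :
    IsIntegral O c := by
  obtain ⟨p, hp, hpb⟩ := hb
  refine ⟨p, hp, ?_⟩
  have : Nontrivial B := by
    by_contra! h
    simp [spectrum.of_subsingleton] at hc
  have mem := spectrum.subset_polynomial_aeval b (p.map (algebraMap O K)) ⟨c, hc, rfl⟩
  rw [Polynomial.aeval_map_algebraMap, Polynomial.aeval_def, hpb, spectrum.zero_eq] at mem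
  simpa [Polynomial.eval_map] using mem

theorem isIntegral_trace_matrix {n : Type*} [Fintype n] [DecidableEq n] {M : Matrix n n K}
    (hM : IsIntegral O M) : IsIntegral O M.trace := by
  let C := AlgebraicClosure K
  let f : Matrix n n K →ₐ[O] Matrix n n C := (IsScalarTower.toAlgHom O K C).mapMatrix
  rw [← isIntegral_algebraMap_iff (algebraMap K C).injective]
  have trace_eq : algebraMap K C M.trace = (f M).charpoly.roots.sum := by
    rw [← Matrix.trace_eq_sum_roots_charpoly, AddMonoidHom.map_trace (algebraMap K C)]
    rfl
  rw [trace_eq]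
  refine IsIntegral.multiset_sum fun c hc => ?_
  exact isIntegral_of_mem_spectrum (hM.map f)
    (Matrix.mem_spectrum_of_isRoot_charpoly (Polynomial.isRoot_of_mem_roots hc))

theorem IsSchurFamily.mem_range_algebraMap [IsIntegrallyClosed O] [IsFractionRing O K]
    {A : Type*} [Ring A] [Algebra O A] [Module.Finite O A] {κ : Type*} [Fintype κ] {t : A →ₗ[O] O}
    {β β' : κ → A} {ι : Type*} [DecidableEq ι] {n : ι → Type*} [∀ i, Fintype (n i)]
    [∀ i, DecidableEq (n i)] {φ : K ⊗[O] A ≃ₐ[K] Π i, Matrix (n i) (n i) K} {s : ι → K}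
    (hs : IsSchurFamily φ (extendForm K t) s) (hβ : IsDualSystem t β β')
    (ht : ∀ a b, t (a * b) = t (b * a)) (i : ι) [Nonempty (n i)] :
    s i ∈ Set.range (algebraMap O K) := by
  let ρ : A →ₐ[O] Matrix (n i) (n i) K :=
    ((factorRep φ i).restrictScalars O).comp Algebra.TensorProduct.includeRight
  have isIntegral_apply (a : A) : IsIntegral O (ρ a) := (Algebra.IsIntegral.isIntegral a).map ρ
  choose χ hχ using fun a =>
    IsIntegrallyClosed.isIntegral_iff.1 (isIntegral_trace_matrix (isIntegral_apply a))
  have central : ρ (∑ j, χ (β' j) • β j) = algebraMap K _ (s i) := by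
    have := (hs.schurRelations (hβ.baseChange K) (extendForm_trace_comm K ht)).sum_trace_smul i
    rw [Algebra.algebraMap_eq_smul_one, ← this, map_sum]
    refine Finset.sum_congr rfl fun j _ => ?_
    rw [map_smul, ← algebraMap_smul K, hχ]
    rfl
  have : IsIntegral O (algebraMap K (Matrix (n i) (n i) K) (s i)) := central ▸ isIntegral_apply _
  exact IsIntegrallyClosed.isIntegral_iff.1
    ((isIntegral_algebraMap_iff (algebraMap K _).injective).1 this)

end Integrality

theorem exists_algHom_comp_eq {R A B C : Type*} [CommSemiring R] [Semiring A] [Semiring B]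
    [Semiring C] [Algebra R A] [Algebra R B] [Algebra R C] (f : B →ₐ[R] C)
    (hf : Function.Injective f) (g : A →ₐ[R] C) (hg : ∀ a, g a ∈ f.range) :
    ∃ h : A →ₐ[R] B, f.comp h = g := by
  refine ⟨(AlgEquiv.ofInjective f hf).symm.toAlgHom.comp (g.codRestrict _ hg), ?_⟩
  ext a
  exact congr_arg Subtype.val ((AlgEquiv.ofInjective f hf).apply_symm_apply ⟨g a, hg a⟩)

section Lattices

open scoped Matrix

variable {O R K A : Type*} [CommRing O] [CommRing R] [Field K] [Algebra O R] [Algebra O K]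
  [Algebra R K] [IsScalarTower O R K] [Ring A] [Algebra O A] [Module.Finite O A]
  {n : Type*} [Fintype n] [DecidableEq n]

variable (R) in
theorem exists_isLattice_forall_mulVec_mem (ρ : A →ₐ[O] Matrix n n K) :
    ∃ M : Submodule R (n → K), Submodule.IsLattice K M ∧ ∀ a, ∀ m ∈ M, ρ a *ᵥ m ∈ M := by
  let orbit (p : n) : A →ₗ[O] (n → K) :=
    (Matrix.mulVecBilin O O).flip (Pi.single p 1) ∘ₗ ρ.toLinearMap
  let N : Submodule O (n → K) := ⨆ p, LinearMap.range (orbit p)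
  have orbit_apply (p : n) (a : A) : orbit p a = ρ a *ᵥ Pi.single p 1 := rfl
  have orbit_mem (p : n) (a : A) : orbit p a ∈ N := Submodule.mem_iSup_of_mem p ⟨a, rfl⟩
  have mulVec_mem (a : A) : ∀ m ∈ N, ρ a *ᵥ m ∈ N := by
    suffices N ≤ N.comap (Matrix.mulVecLin (ρ a) |>.restrictScalars O) from this
    refine iSup_le fun p => ?_
    rintro _ ⟨c, rfl⟩
    have : ρ a *ᵥ orbit p c = orbit p (a * c) := by
      rw [orbit_apply, orbit_apply, map_mul, Matrix.mulVec_mulVec]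
    exact (this ▸ orbit_mem p (a * c) : ρ a *ᵥ orbit p c ∈ N)
  refine ⟨Submodule.span R N, ⟨?_, ?_⟩, fun a => ?_⟩
  · obtain ⟨S, hS⟩ : N.FG := Submodule.fg_iSup _ fun p => Submodule.fg_range _
    exact ⟨S, by rw [← hS, Submodule.span_span_of_tower]⟩
  · rw [eq_top_iff, ← (Pi.basisFun K n).span_eq, Submodule.span_le]
    rintro _ ⟨p, rfl⟩
    refine Submodule.subset_span (Submodule.subset_span ?_)
    rw [Pi.basisFun_apply, ← Matrix.one_mulVec (Pi.single p 1), ← map_one ρ]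
    exact orbit_mem p 1
  · suffices Submodule.span R N ≤
      (Submodule.span R N).comap (Matrix.mulVecLin (ρ a) |>.restrictScalars R) from this
    exact Submodule.span_le.2 fun m hm => Submodule.subset_span (mulVec_mem a m hm)

variable [IsDomain R] [ValuationRing R]

theorem free_of_isTorsionFree_of_valuationRing (M : Type*) [AddCommGroup M] [Module R M]
    [Module.Finite R M] [Module.IsTorsionFree R M] : Module.Free R M := by
  have : Module.Flat R M := Module.Flat.flat_iff_torsion_eq_bot_of_isBezout.2
    (Submodule.isTorsionFree_iff_torsion_eq_bot.1 inferInstance)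
  exact Module.free_of_flat_of_isLocalRing

variable [IsFractionRing R K]

variable (R) in
theorem exists_algEquiv_forall_map_eq (ρ : A →ₐ[O] Matrix n n K) :
    ∃ (e : Matrix n n K ≃ₐ[K] Matrix n n K) (σ : A →ₐ[O] Matrix n n R),
      ∀ a, (σ a).map (algebraMap R K) = e (ρ a) := by
  obtain ⟨M, hM, mulVec_mem⟩ := exists_isLattice_forall_mulVec_mem R ρ
  have : Module.Free R M := free_of_isTorsionFree_of_valuationRing M
  let b₀ := Module.Free.chooseBasis R M
  let b := b₀.reindex ((b₀.extendOfIsLattice K).indexEquiv (Pi.basisFun K n))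
  let bK := b.extendOfIsLattice K
  have repr_coe (m : M) (p : n) : bK.repr m p = algebraMap R K (b.repr m p) := by
    have : (m : n → K) = ∑ q, algebraMap R K (b.repr m q) • bK q := by
      conv_lhs => rw [← b.sum_repr m]
      simp only [bK, Module.Basis.extendOfIsLattice_apply, algebraMap_smul, Submodule.coe_sum,
        Submodule.coe_smul]
    rw [this, bK.repr_sum_self]
  let e := (Matrix.toLinAlgEquiv' (R := K) (n := n)).trans (LinearMap.toMatrixAlgEquiv bK)
  have entry_mem (a : A) (p q : n) : ∃ r, algebraMap R K r = e (ρ a) p q := by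
    have mem : ρ a *ᵥ bK q ∈ M := mulVec_mem a _ (by simp [bK])
    exact ⟨b.repr ⟨_, mem⟩ p, by simp [← repr_coe, e, LinearMap.toMatrixAlgEquiv_apply]⟩
  choose r hr using entry_mem
  obtain ⟨σ, hσ⟩ := exists_algHom_comp_eq (IsScalarTower.toAlgHom O R K).mapMatrix
    (Matrix.map_injective (IsFractionRing.injective R K))
    ((e.restrictScalars O).toAlgHom.comp ρ) fun a => ⟨Matrix.of (r a), Matrix.ext (hr a)⟩
  exact ⟨e, σ, fun a => DFunLike.congr_fun hσ a⟩

end Lattices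

section ExtendRep

variable {O R A : Type*} [CommRing O] [CommRing R] [Algebra O R] [Ring A] [Algebra O A]
  {n : Type*} [Fintype n] [DecidableEq n]

/-- The extension of scalars to `F` of a matrix representation of an `O`-algebra over an
`O`-algebra `R`. When `F` is a residue field of `R` this is the reduction of the representation. -/
def extendRep (F : Type*) [CommRing F] [Algebra O F] [Algebra R F] [IsScalarTower O R F]
    (σ : A →ₐ[O] Matrix n n R) : F ⊗[O] A →ₐ[F] Matrix n n F :=
  Algebra.TensorProduct.lift (Algebra.ofId F _) ((IsScalarTower.toAlgHom O R F).mapMatrix.comp σ)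
    fun c _ => Algebra.commute_algebraMap_left c _

variable {F : Type*} [CommRing F] [Algebra O F] [Algebra R F] [IsScalarTower O R F]

@[simp]
theorem extendRep_one_tmul (σ : A →ₐ[O] Matrix n n R) (a : A) :
    extendRep F σ (1 ⊗ₜ a) = (σ a).map (algebraMap R F) :=
  (Algebra.TensorProduct.lift_tmul _ _ _ 1 a).trans (by simp [AlgHom.mapMatrix_apply])

end ExtendRep

section IntegralForms

variable {O R K A : Type*} [CommRing O] [CommRing R] [Field K] [Algebra O R] [Algebra O K]
  [Algebra R K] [IsScalarTower O R K] [Ring A] [Algebra O A] [Module.Finite O A]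
  {ι : Type*} {n : ι → Type*} [∀ i, Fintype (n i)] [∀ i, DecidableEq (n i)]
  [IsDomain R] [ValuationRing R] [IsFractionRing R K]

variable (R) in
theorem exists_algEquiv_forall_factorRep_eq_extendRep
    (φ : K ⊗[O] A ≃ₐ[K] Π i, Matrix (n i) (n i) K) :
    ∃ (ψ : K ⊗[O] A ≃ₐ[K] Π i, Matrix (n i) (n i) K) (σ : Π i, A →ₐ[O] Matrix (n i) (n i) R),
      factorRep ψ = fun i => extendRep K (σ i) := by
  choose e σ h using fun i => exists_algEquiv_forall_map_eq R
    (((factorRep φ i).restrictScalars O).comp Algebra.TensorProduct.includeRight)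
  refine ⟨φ.trans (AlgEquiv.piCongrRight e), σ, funext fun i => ?_⟩
  ext a : 2
  exact (h i a).symm.trans (extendRep_one_tmul (σ i) a).symm

end IntegralForms

section ReductionOfSchurRelations

variable {O R A : Type*} [CommRing O] [CommRing R] [Algebra O R] [Ring A] [Algebra O A]
  {ι κ : Type*} [DecidableEq ι] [Fintype κ] {n : ι → Type*} [∀ i, Fintype (n i)]
  [∀ i, DecidableEq (n i)] {σ : Π i, A →ₐ[O] Matrix (n i) (n i) R} {β β' : κ → A} {s : ι → R}
  {F : Type*} [CommRing F] [Algebra O F] [Algebra R F] [IsScalarTower O R F]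

theorem SchurRelations.baseChange_iff :
    SchurRelations (fun i => extendRep F (σ i)) (fun j => 1 ⊗ₜ β j) (fun j => 1 ⊗ₜ β' j)
        (fun i => algebraMap R F (s i)) ↔
      ∀ i p q l a b, algebraMap R F (∑ j, σ i (β' j) p q * σ l (β j) a b) = algebraMap R F
        (s i * (Pi.single i (Matrix.single q p 1) : Π i, Matrix (n i) (n i) R) l a b) := by
  have map_single (i l : ι) (p q : n i) (a b : n l) :
      algebraMap R F ((Pi.single i (Matrix.single q p 1) : Π i, Matrix (n i) (n i) R) l a b) =
        (Pi.single i (Matrix.single q p 1) : Π i, Matrix (n i) (n i) F) l a b := by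
    rcases eq_or_ne l i with rfl | h
    · simp [Matrix.single_apply, apply_ite (algebraMap R F)]
    · simp [h]
  simp [SchurRelations, map_single]

variable (F) in
theorem SchurRelations.baseChange (h : SchurRelations σ β β' s) :
    SchurRelations (fun i => extendRep F (σ i)) (fun j => 1 ⊗ₜ β j) (fun j => 1 ⊗ₜ β' j)
      (fun i => algebraMap R F (s i)) :=
  baseChange_iff.2 fun i p q l a b => congr_arg _ (h i p q l a b)

theorem SchurRelations.of_baseChange (hF : Function.Injective (algebraMap R F))
    (h : SchurRelations (fun i => extendRep F (σ i)) (fun j => 1 ⊗ₜ β j) (fun j => 1 ⊗ₜ β' j)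
      (fun i => algebraMap R F (s i))) :
    SchurRelations σ β β' s :=
  fun i p q l a b => hF (baseChange_iff.1 h i p q l a b)

end ReductionOfSchurRelations

theorem exists_mul_mul_self_eq {B : Type*} [Ring B] [IsSemisimpleRing B] (w : B) :
    ∃ c, w * c * w = w := by
  obtain ⟨e, he, hspan⟩ := IsSemisimpleRing.ideal_eq_span_idempotent (Ideal.span {w})
  obtain ⟨c, rfl⟩ : ∃ c, c * w = e :=
    Ideal.mem_span_singleton'.1 (hspan ▸ Ideal.mem_span_singleton_self e)
  obtain ⟨d, hd⟩ : ∃ d, d * (c * w) = w :=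
    Ideal.mem_span_singleton'.1 (hspan ▸ Ideal.mem_span_singleton_self w)
  refine ⟨c, ?_⟩
  calc w * c * w = d * ((c * w) * (c * w)) := by rw [mul_assoc, ← mul_assoc d, hd]
    _ = w := by rw [he.eq, hd]

section SemisimplicityCriterion

variable {k : Type u} {B : Type v} [Field k] [Ring B] [Algebra k B] {ι κ : Type*}
  [DecidableEq ι] [Fintype κ] {n : ι → Type*} [∀ i, Fintype (n i)] [∀ i, DecidableEq (n i)]
  {ρ : Π i, B →ₐ[k] Matrix (n i) (n i) k} {β β' : κ → B} {s : ι → k}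

theorem SchurRelations.ne_zero [IsSemisimpleRing B] {τ : B →ₗ[k] k}
    (h : SchurRelations ρ β β' s) (hβ : IsDualSystem τ β β') (hτ : ∀ a b, τ (a * b) = τ (b * a))
    (i : ι) [Nonempty (n i)] : s i ≠ 0 := by
  intro hs
  obtain ⟨p⟩ := ‹Nonempty (n i)›
  let coeff : B →ₗ[k] k := Matrix.entryLinearMap k k p p ∘ₗ (ρ i).toLinearMap
  let w := ∑ j, coeff (β' j) • β j
  have form_mul_w (b : B) : τ (b * w) = ρ i b p p := hβ.form_mul_sum hτ coeff b
  have map_w : ρ i w = 0 := by simpa [w, coeff, hs] using h.sum_smul i p p i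
  obtain ⟨c, hc⟩ := exists_mul_mul_self_eq w
  have : (1 : k) = 0 := calc
    1 = τ (1 * w) := by rw [form_mul_w, map_one, Matrix.one_apply_eq]
    _ = τ (w * c * w) := by rw [hc, one_mul]
    _ = 0 := by simp [form_mul_w, map_w]
  exact one_ne_zero this

theorem SchurRelations.surjective_pi [Finite ι] (h : SchurRelations ρ β β' s) (hs : ∀ i, s i ≠ 0) :
    Function.Surjective (AlgHom.pi ρ) := by
  cases nonempty_fintype ι
  have single_mem (i : ι) (p q : n i) (c : k) :
      Pi.single i (Matrix.single q p c) ∈ (AlgHom.pi ρ).range := by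
    refine ⟨(c / s i) • ∑ j, ρ i (β' j) p q • β j, funext fun l => ?_⟩
    calc ρ l ((c / s i) • ∑ j, ρ i (β' j) p q • β j)
        = c • (Pi.single i (Matrix.single q p 1) : Π i, Matrix (n i) (n i) k) l := by
          simp only [map_smul, map_sum, h.sum_smul, smul_smul, div_mul_cancel₀ c (hs i)]
      _ = (Pi.single i (Matrix.single q p c) : Π i, Matrix (n i) (n i) k) l := by
          rw [← Pi.smul_apply, ← Pi.single_smul, Matrix.smul_single, smul_eq_mul, mul_one]
  intro X
  suffices X ∈ (AlgHom.pi ρ).range from this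
  rw [← Finset.univ_sum_single X]
  refine Subalgebra.sum_mem _ fun i _ => ?_
  rw [← LinearMap.single_apply k (fun i => Matrix (n i) (n i) k), Matrix.matrix_eq_sum_single (X i)]
  simp only [map_sum]
  exact Subalgebra.sum_mem _ fun q _ => Subalgebra.sum_mem _ fun p _ => single_mem i p q _

theorem SchurRelations.isSplitSemisimple [Finite ι] [Module.Finite k B]
    (h : SchurRelations ρ β β' s) (hs : ∀ i, s i ≠ 0)
    (hB : Module.finrank k B = Module.finrank k (Π i, Matrix (n i) (n i) k)) :
    IsSplitSemisimple k B :=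
  isSplitSemisimple_of_algEquiv <| AlgEquiv.ofBijective (AlgHom.pi ρ)
    ⟨(LinearMap.injective_iff_surjective_of_finrank_eq_finrank
      (f := (AlgHom.pi ρ).toLinearMap) hB).2 (h.surjective_pi hs), h.surjective_pi hs⟩

end SemisimplicityCriterion

theorem finrank_tensorProduct_eq_finrank_tensorProduct {O A : Type*} (R K L : Type*) [CommRing O]
    [CommRing R] [IsLocalRing R] [Algebra O R] [AddCommGroup A] [Module O A] [Module.Projective O A]
    [Module.Finite O A]
    [Field K] [Algebra O K] [Algebra R K] [IsScalarTower O R K]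
    [Field L] [Algebra O L] [Algebra R L] [IsScalarTower O R L] :
    Module.finrank K (K ⊗[O] A) = Module.finrank L (L ⊗[O] A) := by
  have : Module.Free R (R ⊗[O] A) := Module.free_of_flat_of_isLocalRing
  rw [← (TensorProduct.AlgebraTensorModule.cancelBaseChange O R K K A).finrank_eq,
    Module.finrank_baseChange (R := K) (S := R) (M' := R ⊗[O] A),
    ← (TensorProduct.AlgebraTensorModule.cancelBaseChange O R L L A).finrank_eq,
    Module.finrank_baseChange (R := L) (S := R) (M' := R ⊗[O] A)]

section KrullRings

open scoped WithZero

theorem exists_forall_mul_le_mul {ι : Type*} {T : Set ι} (hT : T.Finite) (hne : T.Nonempty)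
    (f : ι → ℤ) {g : ι → ℤ} (hg : ∀ i ∈ T, 0 < g i) :
    ∃ i ∈ T, ∀ j ∈ T, f j * g i ≤ f i * g j := by
  obtain ⟨i, hi, hmax⟩ := T.exists_max_image (fun i => (f i : ℚ) / g i) hT hne
  refine ⟨i, hi, fun j hj => ?_⟩
  have := hmax j hj
  rw [div_le_div_iff₀ (by exact_mod_cast hg j hj) (by exact_mod_cast hg i hi)] at this
  exact_mod_cast this

theorem exists_forall_map_pow_mul_pow_le_one {K : Type*} [Field K] {T : Set (Valuation K ℤᵐ⁰)}
    (hT : T.Finite) {a x : K} (ha0 : a ≠ 0) (ha : ∀ τ ∈ T, τ a < 1) (hx : ∃ τ ∈ T, 1 < τ x) :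
    ∃ l k : ℕ, k ≠ 0 ∧ (∀ τ ∈ T, τ (x ^ l * a ^ k) ≤ 1) ∧ ∃ ν ∈ T, ν (x ^ l * a ^ k) = 1 := by
  obtain ⟨σ, hσT, hσx⟩ := hx
  have hx0 : x ≠ 0 := by rintro rfl; simp at hσx
  have log_a_neg (τ) (hτ : τ ∈ T) : WithZero.log (τ a) < 0 := by
    rw [← WithZero.log_one, WithZero.log_lt_log (by simpa) one_ne_zero]
    exact ha τ hτ
  have log_x_pos : 0 < WithZero.log (σ x) := by
    rwa [← WithZero.log_one, WithZero.log_lt_log one_ne_zero (by simpa)]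
  -- Maximizing `-log (τ x) / log (τ a)` yields a monomial in `x` and `a` of exponent `0` at `ν`.
  obtain ⟨ν, hνT, hν⟩ := exists_forall_mul_le_mul hT ⟨σ, hσT⟩ (fun τ => WithZero.log (τ x))
    (g := fun τ => -WithZero.log (τ a)) fun τ hτ => neg_pos.2 (log_a_neg τ hτ)
  have log_νx_pos : 0 < WithZero.log (ν x) :=
    pos_of_mul_pos_left ((mul_pos log_x_pos (neg_pos.2 (log_a_neg ν hνT))).trans_le (hν σ hσT))
      (neg_pos.2 (log_a_neg σ hσT)).le
  obtain ⟨k, hk⟩ : ∃ k : ℕ, WithZero.log (ν x) = k := Int.eq_ofNat_of_zero_le log_νx_pos.le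
  obtain ⟨l, hl⟩ : ∃ l : ℕ, -WithZero.log (ν a) = l :=
    Int.eq_ofNat_of_zero_le (neg_nonneg.2 (log_a_neg ν hνT).le)
  have log_eq (τ : Valuation K ℤᵐ⁰) : WithZero.log (τ (x ^ l * a ^ k)) =
      WithZero.log (τ x) * -WithZero.log (ν a) - WithZero.log (ν x) * -WithZero.log (τ a) := by
    rw [map_mul, map_pow, map_pow, WithZero.log_mul (by simp [hx0]) (by simp [ha0]),
      WithZero.log_pow, WithZero.log_pow, hk, hl, nsmul_eq_mul, nsmul_eq_mul]
    ring
  have ne_zero (τ : Valuation K ℤᵐ⁰) : τ (x ^ l * a ^ k) ≠ 0 := by simp [hx0, ha0]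
  refine ⟨l, k, by lia, fun τ hτ => ?_, ν, hνT, ?_⟩
  · rw [← WithZero.log_le_log (ne_zero τ) one_ne_zero, WithZero.log_one, log_eq, sub_nonpos]
    exact hν τ hτ
  · rw [← WithZero.exp_log (ne_zero ν), log_eq, sub_self, WithZero.exp_zero]

/-- The set `S` of discrete valuations of `K` exhibits the domain `O` with field of fractions `K`
as a Krull ring. -/
structure IsKrullFamily (O : Type*) {K : Type*} [CommRing O] [Field K] [Algebra O K]
    (S : Set (Valuation K ℤᵐ⁰)) : Prop where
  surjective : ∀ ν ∈ S, Function.Surjective ν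
  mem_range_iff : ∀ x : K, (∀ ν ∈ S, ν x ≤ 1) ↔ x ∈ Set.range (algebraMap O K)
  finite : ∀ x : K, x ≠ 0 → {ν ∈ S | ν x ≠ 1}.Finite

/-- The valuation `ν` is centred at the ideal `P` of `O`: the elements of `O` at which `ν` is
smaller than `1` are those of `P`. -/
def IsCentredAt {O K : Type*} [CommRing O] [Field K] [Algebra O K] (ν : Valuation K ℤᵐ⁰)
    (P : Ideal O) : Prop :=
  ∀ x : O, ν (algebraMap O K x) < 1 ↔ x ∈ P

variable {O K : Type*} [CommRing O] [Field K] [Algebra O K]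

theorem exists_isPrime_isCentredAt {ν : Valuation K ℤᵐ⁰} (hν : ∀ x : O, ν (algebraMap O K x) ≤ 1) :
    ∃ Q : Ideal O, Q.IsPrime ∧ IsCentredAt ν Q :=
  ⟨(IsLocalRing.maximalIdeal ν.valuationSubring).comap
    ((algebraMap O K).codRestrict ν.valuationSubring hν), inferInstance,
    fun x => (Valuation.mem_maximalIdeal_iff (a := ⟨algebraMap O K x, hν x⟩) K ν).symm⟩

theorem IsCentredAt.ne_bot [Nontrivial O] [IsFractionRing O K] {ν : Valuation K ℤᵐ⁰} {Q : Ideal O}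
    (hQ : IsCentredAt ν Q) (hν : ∀ x : O, ν (algebraMap O K x) ≤ 1)
    (hsurj : Function.Surjective ν) : Q ≠ ⊥ := by
  obtain ⟨y, hy⟩ := hsurj (WithZero.exp (-1))
  obtain ⟨p, q, hq, rfl⟩ := IsFractionRing.div_surjective (A := O) y
  rintro rfl
  have hq0 : algebraMap O K q ≠ 0 := IsFractionRing.to_map_ne_zero_of_mem_nonZeroDivisors hq
  have : ν (algebraMap O K p) < 1 := by
    rw [← div_mul_cancel₀ (algebraMap O K p) hq0, map_mul, hy]
    refine mul_lt_one_of_lt_of_le ?_ (hν q)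
    rw [← WithZero.exp_zero, WithZero.exp_lt_exp]
    norm_num
  have : p = 0 := Ideal.mem_bot.1 ((hQ p).1 this)
  rw [this, map_zero, zero_div, map_zero] at hy
  exact WithZero.exp_ne_zero hy.symm

namespace IsKrullFamily

variable {S : Set (Valuation K ℤᵐ⁰)}

theorem map_algebraMap_le_one (hS : IsKrullFamily O S) {ν : Valuation K ℤᵐ⁰} (hν : ν ∈ S) (x : O) :
    ν (algebraMap O K x) ≤ 1 :=
  (hS.mem_range_iff _).2 ⟨x, rfl⟩ ν hν

theorem isIntegrallyClosed [IsFractionRing O K] (hS : IsKrullFamily O S) :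
    IsIntegrallyClosed O := by
  refine (isIntegrallyClosed_iff K).2 fun {x} hx => (hS.mem_range_iff x).1 fun ν hν => ?_
  have : IsIntegral ν.valuationSubring x := hx.map_of_comp_eq
    ((algebraMap O K).codRestrict ν.valuationSubring (hS.map_algebraMap_le_one hν)) (.id K) rfl
  exact (Valuation.valuationSubring.integers ν).mem_of_integral this

theorem finite_isCentredAt [IsDomain O] [IsFractionRing O K] (hS : IsKrullFamily O S)
    {P : Ideal O} (hP : P.height = 1) : {ν ∈ S | IsCentredAt ν P}.Finite := by
  obtain ⟨a, haP, ha0⟩ := P.ne_bot_iff.1 (Ideal.ne_bot_of_height_eq_one hP)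
  exact (hS.finite (algebraMap O K a) (by simpa)).subset
    fun ν hν => ⟨hν.1, ((hν.2 a).2 haP).ne⟩

variable [IsDomain O] [IsFractionRing O K] {P : Ideal O} [P.IsPrime]

theorem exists_notMem_map_mul_le_one (hS : IsKrullFamily O S) (hP : P.height = 1)
    {ν : Valuation K ℤᵐ⁰} (hν : ν ∈ S) {x : K} (hx : IsCentredAt ν P → ν x ≤ 1) :
    ∃ b ∉ P, ν (algebraMap O K b * x) ≤ 1 := by
  have map_le_one := hS.map_algebraMap_le_one hν
  by_cases hνP : IsCentredAt ν P
  · exact ⟨1, (Ideal.ne_top_iff_one P).1 Ideal.IsPrime.ne_top', by simpa using hx hνP⟩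
  obtain ⟨Q, hQ, hνQ⟩ := exists_isPrime_isCentredAt map_le_one
  obtain ⟨b, hbQ, hbP⟩ : ∃ b ∈ Q, b ∉ P := by
    by_contra! hQP
    have height_ne_zero : Q.height ≠ 0 := by simpa using hνQ.ne_bot map_le_one (hS.surjective ν hν)
    have : Q.FiniteHeight := ⟨Or.inr ((Ideal.height_mono hQP).trans_lt (by simp [hP])).ne⟩
    have : Q = P := Ideal.eq_of_le_of_height_le Q hQP <| by
      rwa [hP, Order.one_le_iff_ne_zero]
    exact hνP (this ▸ hνQ)
  have hb0 : ν (algebraMap O K b) ≠ 0 := by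
    rw [ν.ne_zero_iff, ne_eq, FaithfulSMul.algebraMap_eq_zero_iff]
    exact fun hb => hbP (hb ▸ P.zero_mem)
  obtain ⟨n, hn⟩ := MulArchimedean.arch (ν x)
    ((one_lt_inv₀ (zero_lt_iff.mpr hb0)).2 ((hνQ b).2 hbQ))
  refine ⟨b ^ n, fun hb => hbP (Ideal.IsPrime.mem_of_pow_mem ‹_› n hb), ?_⟩
  calc ν (algebraMap O K (b ^ n) * x) = ν (algebraMap O K b) ^ n * ν x := by simp
    _ ≤ ν (algebraMap O K b) ^ n * (ν (algebraMap O K b))⁻¹ ^ n := by gcongr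
    _ = 1 := by rw [← mul_pow, mul_inv_cancel₀ hb0, one_pow]

theorem exists_notMem_mul_mem_range (hS : IsKrullFamily O S) (hP : P.height = 1) {x : K}
    (hx : ∀ ν ∈ S, IsCentredAt ν P → ν x ≤ 1) :
    ∃ b ∉ P, algebraMap O K b * x ∈ Set.range (algebraMap O K) := by
  classical
  rcases eq_or_ne x 0 with rfl | hx0
  · exact ⟨1, (Ideal.ne_top_iff_one P).1 Ideal.IsPrime.ne_top', 0, by simp⟩
  choose! b hbP hb using fun ν hν => hS.exists_notMem_map_mul_le_one hP hν (hx ν hν)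
  let bad := (hS.finite x hx0).toFinset
  have mem_S {ν} (hν : ν ∈ bad) : ν ∈ S := ((hS.finite x hx0).mem_toFinset.1 hν).1
  refine ⟨∏ ν ∈ bad, b ν, fun hprod => ?_, (hS.mem_range_iff _).1 fun ν hν => ?_⟩
  · obtain ⟨ν, hν, hmem⟩ := (Ideal.IsPrime.prod_mem_iff (p := P)).1 hprod
    exact hbP ν (mem_S hν) hmem
  by_cases hbad : ν ∈ bad
  · rw [← Finset.mul_prod_erase _ _ hbad, map_mul (algebraMap O K), mul_right_comm, map_mul]
    exact mul_le_one' (hb ν hν) (hS.map_algebraMap_le_one hν _)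
  · have : ν x = 1 := by simpa [bad, hν] using hbad
    rw [map_mul, this, mul_one]
    exact hS.map_algebraMap_le_one hν _

theorem map_le_one_of_isCentredAt (hS : IsKrullFamily O S) (hP : P.height = 1)
    {μ ν : Valuation K ℤᵐ⁰} (hμ : μ ∈ S) (hμP : IsCentredAt μ P) (hν : ν ∈ S)
    (hνP : IsCentredAt ν P) {x : K} (hx : μ x ≤ 1) : ν x ≤ 1 := by
  by_contra! hνx
  -- A monomial `x ^ l * a ^ k` that is a unit at some `τ` but not at `μ` would separate two
  -- valuations with the same centre.
  obtain ⟨a, haP, ha0⟩ := P.ne_bot_iff.1 (Ideal.ne_bot_of_height_eq_one hP)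
  obtain ⟨l, k, hk, map_le_one, τ, ⟨-, hτP⟩, map_eq_one⟩ :=
    exists_forall_map_pow_mul_pow_le_one (a := algebraMap O K a) (hS.finite_isCentredAt hP)
      (by simpa) (fun τ hτ => (hτ.2 a).2 haP) ⟨ν, ⟨hν, hνP⟩, hνx⟩
  obtain ⟨b, hbP, y, hy⟩ :=
    hS.exists_notMem_mul_mem_range hP fun τ hτ hτP => map_le_one τ ⟨hτ, hτP⟩
  have : μ (algebraMap O K y) < 1 := by
    rw [hy, map_mul, map_mul, map_pow, map_pow]
    refine (mul_le_of_le_one_left' (hS.map_algebraMap_le_one hμ b)).trans_lt ?_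
    exact (mul_le_of_le_one_left' (pow_le_one' hx l)).trans_lt
      (pow_lt_one₀ zero_le ((hμP a).2 haP) hk)
  have : τ (algebraMap O K b * (x ^ l * algebraMap O K a ^ k)) < 1 := by
    rwa [← hy, hτP, ← hμP]
  rw [map_mul, map_eq_one, mul_one, hτP] at this
  exact hbP this

theorem mem_ofField_of_forall_map_le_one (hS : IsKrullFamily O S) (hP : P.height = 1) {x : K}
    (hx : ∀ ν ∈ S, IsCentredAt ν P → ν x ≤ 1) :
    x ∈ Localization.subalgebra.ofField K P.primeCompl P.primeCompl_le_nonZeroDivisors := by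
  obtain ⟨b, hbP, y, hy⟩ := hS.exists_notMem_mul_mem_range hP hx
  have hb0 : algebraMap O K b ≠ 0 := by
    simpa using ne_of_mem_of_not_mem P.zero_mem hbP |>.symm
  exact ⟨y, b, hbP, by rw [hy]; field_simp⟩

theorem mem_ofField_or_inv_mem_ofField (hS : IsKrullFamily O S) (hP : P.height = 1) (x : K) :
    x ∈ Localization.subalgebra.ofField K P.primeCompl P.primeCompl_le_nonZeroDivisors ∨
      x⁻¹ ∈ Localization.subalgebra.ofField K P.primeCompl P.primeCompl_le_nonZeroDivisors := by
  by_cases! hx : ∀ ν ∈ S, IsCentredAt ν P → ν x ≤ 1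
  · exact Or.inl (hS.mem_ofField_of_forall_map_le_one hP hx)
  obtain ⟨ν, hν, hνP, hνx⟩ := hx
  refine Or.inr (hS.mem_ofField_of_forall_map_le_one hP fun μ hμ hμP => ?_)
  rw [map_inv₀]
  refine inv_le_one_of_one_le₀ (not_lt.1 fun hμx => hνx.not_ge ?_)
  exact hS.map_le_one_of_isCentredAt hP hμ hμP hν hνP hμx.le

end IsKrullFamily

theorem IsKrullRing.exists_isKrullFamily {O : Type u} {K : Type v} [CommRing O] [IsDomain O]
    [Field K] [Algebra O K] [IsFractionRing O K] (hO : IsKrullRing O K) :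
    ∃ S : Set (Valuation K ℤᵐ⁰), IsKrullFamily O S :=
  let ⟨S, surjective, mem_range_iff, finite⟩ := hO
  ⟨S, surjective, mem_range_iff, finite⟩

theorem IsKrullRing.isIntegrallyClosed {O : Type u} {K : Type v} [CommRing O] [IsDomain O]
    [Field K] [Algebra O K] [IsFractionRing O K] (hO : IsKrullRing O K) : IsIntegrallyClosed O :=
  let ⟨_, hS⟩ := hO.exists_isKrullFamily
  hS.isIntegrallyClosed

theorem IsKrullRing.exists_valuationSubring_extension {O : Type u} {K : Type v} {L : Type w}
    [CommRing O] [IsDomain O] [Field K] [Algebra O K] [IsFractionRing O K] (hO : IsKrullRing O K)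
    [Field L] [Algebra O L] (hker : (RingHom.ker (algebraMap O L)).height = 1) :
    ∃ (W : ValuationSubring K) (_ : Algebra O W) (_ : Algebra W L),
      IsScalarTower O W K ∧ IsScalarTower O W L := by
  obtain ⟨S, hS⟩ := hO.exists_isKrullFamily
  let P := RingHom.ker (algebraMap O L)
  have : P.IsPrime := RingHom.ker_isPrime _
  let OP := Localization.subalgebra.ofField K P.primeCompl P.primeCompl_le_nonZeroDivisors
  let W : ValuationSubring K :=
    { OP.toSubring with mem_or_inv_mem' := hS.mem_ofField_or_inv_mem_ofField hker }
  let θ : OP →+* L := IsLocalization.lift (M := P.primeCompl) (g := algebraMap O L)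
    fun b => IsUnit.mk0 _ b.2
  let _ : Algebra O W := inferInstanceAs (Algebra O OP)
  let _ : Algebra W L := RingHom.toAlgebra (R := OP) θ
  have : IsScalarTower O W K := inferInstanceAs (IsScalarTower O OP K)
  exact ⟨W, ‹_›, ‹_›, this,
    .of_algebraMap_eq fun x => (IsLocalization.lift_eq (S := OP) _ x).symm⟩

end KrullRings

section SchurElementCriterion

variable {O R K L A : Type*} [CommRing O] [Field K] [Algebra O K] [Ring A] [Algebra O A]
  [Module.Finite O A] {t : A →ₗ[O] O} {ι κ : Type*} [DecidableEq ι] [Fintype κ] {β β' : κ → A}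
  {n : ι → Type*} [∀ i, Fintype (n i)] [∀ i, DecidableEq (n i)]
  {φ : K ⊗[O] A ≃ₐ[K] Π i, Matrix (n i) (n i) K}

theorem IsDualSystem.exists_isSchurFamily_algebraMap [IsIntegrallyClosed O] [IsFractionRing O K]
    [∀ i, Nonempty (n i)] (hβ : IsDualSystem t β β') (ht : ∀ a b, t (a * b) = t (b * a))
    (φ : K ⊗[O] A ≃ₐ[K] Π i, Matrix (n i) (n i) K) :
    ∃ s : ι → O, IsSchurFamily φ (extendForm K t) fun i => algebraMap O K (s i) := by
  obtain ⟨s, hs⟩ := (hβ.baseChange K).exists_isSchurFamily (extendForm_trace_comm K ht) φ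
  choose s₀ hs₀ using fun i => hs.mem_range_algebraMap hβ ht i
  obtain rfl : (fun i => algebraMap O K (s₀ i)) = s := funext hs₀
  exact ⟨s₀, hs⟩

variable [CommRing R] [IsDomain R] [ValuationRing R] [Algebra O R] [Algebra R K]
  [IsFractionRing R K] [IsScalarTower O R K] [Field L] [Algebra O L] [Algebra R L]
  [IsScalarTower O R L]

theorem IsSchurFamily.isSplitSemisimple_iff [Module.Projective O A] [Finite ι]
    [∀ i, Nonempty (n i)] {σ : Π i, A →ₐ[O] Matrix (n i) (n i) R}
    (hφ : factorRep φ = fun i => extendRep K (σ i)) {s : ι → O}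
    (hs : IsSchurFamily φ (extendForm K t) fun i => algebraMap O K (s i))
    (hβ : IsDualSystem t β β') (ht : ∀ a b, t (a * b) = t (b * a)) :
    IsSplitSemisimple L (L ⊗[O] A) ↔ ∀ i, algebraMap O L (s i) ≠ 0 := by
  have relations_K := hs.schurRelations (hβ.baseChange K) (extendForm_trace_comm K ht)
  simp only [hφ, IsScalarTower.algebraMap_apply O R K] at relations_K
  have relations_L := (SchurRelations.of_baseChange (s := fun i => algebraMap O R (s i))
    (IsFractionRing.injective R K) relations_K).baseChange L
  simp only [← IsScalarTower.algebraMap_apply O R L] at relations_L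
  constructor
  · rintro ⟨_, -⟩ i
    exact relations_L.ne_zero (hβ.baseChange L) (extendForm_trace_comm L ht) i
  · refine fun h => relations_L.isSplitSemisimple h ?_
    cases nonempty_fintype ι
    rw [← finrank_tensorProduct_eq_finrank_tensorProduct R K L, φ.toLinearEquiv.finrank_eq]
    simp [Module.finrank_pi_fintype, Module.finrank_matrix]

end SchurElementCriterion

theorem mainTheorem7_general {O : Type u} {K : Type v} {L : Type w} {A : Type x}
    [CommRing O] [IsIntegrallyClosed O] [Field K] [Algebra O K] [IsFractionRing O K]
    [Ring A] [Algebra O A] [Module.Projective O A] [Module.Finite O A]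
    (hKA : IsSplitSemisimple K (K ⊗[O] A))
    (t : A →ₗ[O] O) (ht : IsSymmetrizingForm t)
    [Field L] [Algebra O L]
    (R : Type*) [CommRing R] [IsDomain R] [ValuationRing R] [Algebra O R]
    [Algebra R K] [IsFractionRing R K] [IsScalarTower O R K]
    [Algebra R L] [IsScalarTower O R L] :
    (∀ (V : Type (max v x)) [AddCommGroup V] [Module (K ⊗[O] A) V] [Module K V]
      [IsScalarTower K (K ⊗[O] A) V], IsSimpleModule (K ⊗[O] A) V →
        (∃! s : K, IsSchurElement (extendForm K t) V s) ∧
        ∃! s : O, IsSchurElement (extendForm K t) V (algebraMap O K s)) ∧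
    (IsSplitSemisimple L (L ⊗[O] A) ↔
      ∀ (V : Type (max v x)) [AddCommGroup V] [Module (K ⊗[O] A) V] [Module K V]
        [IsScalarTower K (K ⊗[O] A) V], IsSimpleModule (K ⊗[O] A) V →
          ∀ s : O, IsSchurElement (extendForm K t) V (algebraMap O K s) →
            algebraMap O L s ≠ 0) := by
  obtain ⟨m, d, _, ⟨φ₀⟩⟩ := hKA.exists_algEquiv
  obtain ⟨φ, σ, hφ⟩ := exists_algEquiv_forall_factorRep_eq_extendRep R φ₀
  obtain ⟨_, β, β', hβ⟩ := ht.exists_isDualSystem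
  obtain ⟨s, hs⟩ := hβ.exists_isSchurFamily_algebraMap ht.trace_comm φ
  have schurElement_eq (V : Type (max v x)) [AddCommGroup V] [Module (K ⊗[O] A) V] [Module K V]
      [IsScalarTower K (K ⊗[O] A) V] (hV : IsSimpleModule (K ⊗[O] A) V) :=
    hs.exists_forall_isSchurElement_iff (hβ.baseChange K)
      (extendForm_trace_comm K ht.trace_comm) hV
  refine ⟨fun V _ _ _ _ hV => ?_, (hs.isSplitSemisimple_iff hφ hβ ht.trace_comm).trans
    ⟨fun h V _ _ _ _ hV c hc => ?_, fun h i => ?_⟩⟩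
  · obtain ⟨i, hi⟩ := schurElement_eq V hV
    simp [hi, (IsFractionRing.injective O K).eq_iff]
  · obtain ⟨i, hi⟩ := schurElement_eq V hV
    exact IsFractionRing.injective O K ((hi _).1 hc) ▸ h i
  · exact h _ (isSimpleModule_columnIdeal φ i 0) (s i) <|
      hs.isSchurElement_columnIdeal (hβ.baseChange K) (extendForm_trace_comm K ht.trace_comm) i 0

theorem mainTheorem7 {O : Type u} {K : Type v} {L : Type w} {A : Type x}
    [CommRing O] [IsDomain O] [Field K] [Algebra O K] [IsFractionRing O K]
    (hO : IsKrullRing O K)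
    [Ring A] [Algebra O A] [Module.Free O A] [Module.Finite O A]
    (hKA : IsSplitSemisimple K (K ⊗[O] A))
    (t : A →ₗ[O] O) (ht : IsSymmetrizingForm t)
    [Field L] [Algebra O L] (hθ : IsSpecialization (algebraMap O L))
    (hker : (RingHom.ker (algebraMap O L)).height = 1) :
    -- the Schur element of every simple `KA`-module is well defined and lies in `O`
    (∀ (V : Type (max v x)) [AddCommGroup V] [Module (K ⊗[O] A) V] [Module K V]
      [IsScalarTower K (K ⊗[O] A) V], IsSimpleModule (K ⊗[O] A) V →
        (∃! s : K, IsSchurElement (extendForm K t) V s) ∧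
        ∃! s : O, IsSchurElement (extendForm K t) V (algebraMap O K s)) ∧
    (IsSplitSemisimple L (L ⊗[O] A) ↔
      ∀ (V : Type (max v x)) [AddCommGroup V] [Module (K ⊗[O] A) V] [Module K V]
        [IsScalarTower K (K ⊗[O] A) V], IsSimpleModule (K ⊗[O] A) V →
          ∀ s : O, IsSchurElement (extendForm K t) V (algebraMap O K s) →
            algebraMap O L s ≠ 0) := by
  have := hO.isIntegrallyClosed
  obtain ⟨W, _, _, _, _⟩ := hO.exists_valuationSubring_extension hker
  exact mainTheorem7_general hKA t ht W
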